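/- Let $A\subset\mathbb C[z]$ be a unital subalgebra, let $\mathfrak c=\{f\in A: f\,\mathbb C[z]\subset A\}$ be its conductor (an ideal of $\mathbb C[z]$), and assume that all points of the support of $\mathfrak c$ (the common zeros in $\mathbb C$ of the elements of $\mathfrak c$) lie in the open unit disc $\mathbb D$; in particular $\mathfrak c\neq 0$. Regard $H^2$ and $H^\infty$ as spaces of boundary functions on the unit circle $\mathbb T$, and let $\mathfrak A\subset H^\infty$ be the weak-$*$ closure of $A$. Put $\mathcal C=\overline{\mathfrak c H^2}$ (closed linear span in $H^2$). Then $\mathcal C=B_{\mathfrak c}H^2$, where $B_{\mathfrak c}(z)=\prod_j\bigl(\frac{z-\alpha_j}{1-\overline{\alpha_j}z}\bigr)^{m_j}$ if $\prod_j(z-\alpha_j)^{m_j}$ is the monic generator of $\mathfrak c$. For an $A/\mathfrak c$-submodule $M\subset\mathbb C[z]/\mathfrak c$ set $H^2_M=M\oplus\mathcal C=M\oplus B_{\mathfrak c}H^2$, where $M$ is viewed in $H^2\ominus\mathcal C$ through the map $\mathbb C[z]/\mathfrak c\to H^2\ominus\mathcal C$, $p+\mathfrak c\mapsto P_{\mathcal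 C^\perp}p$. (Generalized Helson–Lowdenslager theorem.) Let $\mathcal N\subset L^2(\mathbb T)$ be a closed $\mathfrak A$-invariant subspace that is not $H^\infty$-invariant. Then there exist an $A/\mathfrak c$-submodule $M\subset\mathbb C[z]/\mathfrak c$ and a unimodular measurable function $J$ on $\mathbb T$ (that is, $|J|=1$ almost everywhere) such that $\mathcal N=J\,H^2_M$. -/

import Mathlib

open MeasureTheory Polynomial
open scoped ENNReal Topology ComplexConjugate

namespace HelsonLowdenslager

/-- Normalized Lebesgue (Haar) measure on the unit circle `𝕋`, which is parametrized by
`ℝ / ℤ` through `t ↦ exp (2 π i t)`. -/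
noncomputable abbrev circleMeasure : Measure UnitAddCircle := AddCircle.haarAddCircle

/-- The space `L^p(𝕋)`. -/
noncomputable abbrev LpT (p : ℝ≥0∞) := Lp ℂ p circleMeasure

/-- The product `a f ∈ L²(𝕋)` of `a ∈ L^∞(𝕋)` and `f ∈ L²(𝕋)`. -/
noncomputable def mulL2 (a : LpT ∞) (f : LpT 2) : LpT 2 := a • f

theorem integrable_LpT {p : ℝ≥0∞} [hp : Fact (1 ≤ p)] (f : LpT p) :
    Integrable (f : UnitAddCircle → ℂ) circleMeasure :=
  (Lp.memLp f).integrable hp.out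

/-- The Hardy space `H^p(𝕋)`, realized by boundary values: the functions in `L^p(𝕋)` whose
Fourier coefficients of negative index vanish. `Hardy 2` is `H²` and `Hardy ∞` is `H^∞`. -/
noncomputable def Hardy (p : ℝ≥0∞) [Fact (1 ≤ p)] : Submodule ℂ (LpT p) where
  carrier := {f | ∀ n : ℤ, n < 0 → fourierCoeff (f : UnitAddCircle → ℂ) n = 0}
  zero_mem' n _ := by
    rw [fourierCoeff_congr_ae (Lp.coeFn_zero ℂ p circleMeasure)]
    simp [fourierCoeff]
  add_mem' {f g} hf hg n hn := by
    rw [fourierCoeff_congr_ae (Lp.coeFn_add f g),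
      fourierCoeff.add (integrable_LpT f) (integrable_LpT g), Pi.add_apply, hf n hn, hg n hn,
      add_zero]
  smul_mem' c f hf n hn := by
    rw [fourierCoeff_congr_ae (Lp.coeFn_smul c f), fourierCoeff.const_smul, hf n hn, smul_zero]

/-- The restriction of a polynomial in `z` to the unit circle, as a continuous function;
`fourier 1` is the coordinate function `z = exp (2 π i t)`. -/
noncomputable def polyCircle : ℂ[X] →ₐ[ℂ] C(UnitAddCircle, ℂ) := Polynomial.aeval (fourier 1)

/-- A polynomial as an element of `L^∞(𝕋)`. -/
noncomputable def polyLinfty (f : ℂ[X]) : LpT ∞ :=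
  ContinuousMap.toLp ∞ circleMeasure ℂ (polyCircle f)

/-- The linear map that sends a polynomial to its class in `L²(𝕋)`. -/
noncomputable def polyL2 : ℂ[X] →ₗ[ℂ] LpT 2 :=
  (ContinuousMap.toLp (E := ℂ) 2 circleMeasure ℂ).toLinearMap ∘ₗ polyCircle.toLinearMap

/-- The weak-* topology of `L^∞(𝕋) = L¹(𝕋)*`: the coarsest topology for which all the functionals
`f ↦ ∫ f g` with `g ∈ L¹(𝕋)` are continuous. -/
@[reducible] noncomputable def weakStar : TopologicalSpace (LpT ∞) :=
  TopologicalSpace.induced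
    (fun (f : LpT ∞) (g : LpT 1) => ∫ t, f t * g t ∂circleMeasure) Pi.topologicalSpace

/-- The weak-* closure `𝔄` of an algebra `A` of polynomials (`H^∞` is weak-* closed in `L^∞`,
so this is also the closure within `H^∞`). -/
noncomputable def weakStarClosure (A : Subalgebra ℂ ℂ[X]) : Set (LpT ∞) :=
  closure[weakStar] (polyLinfty '' (A : Set ℂ[X]))

/-- The conductor `𝔠 = {f ∈ A : f ℂ[z] ⊆ A}` of `A` in `ℂ[z]`, an ideal of `ℂ[z]`. -/
def conductorIdeal (A : Subalgebra ℂ ℂ[X]) : Ideal ℂ[X] where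
  carrier := {f | f ∈ A ∧ ∀ g : ℂ[X], f * g ∈ A}
  zero_mem' := ⟨A.zero_mem, fun g => by rw [zero_mul]; exact A.zero_mem⟩
  add_mem' ha hb :=
    ⟨A.add_mem ha.1 hb.1, fun g => by rw [add_mul]; exact A.add_mem (ha.2 g) (hb.2 g)⟩
  smul_mem' c a ha :=
    ⟨by rw [smul_eq_mul, mul_comm]; exact ha.2 c,
      fun g => by rw [smul_eq_mul, mul_comm c a, mul_assoc]; exact ha.2 (c * g)⟩

/-- The ring `A / 𝔠`, as a subalgebra of `ℂ[z] / 𝔠`. -/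
noncomputable abbrev quotAlg (A : Subalgebra ℂ ℂ[X]) : Subalgebra ℂ (ℂ[X] ⧸ conductorIdeal A) :=
  A.map (Ideal.Quotient.mkₐ ℂ (conductorIdeal A))

/-- The closed subspace `𝒞` of `H²` generated by the products `f h`, `f ∈ 𝔠`, `h ∈ H²`. -/
noncomputable def conductorSpace (A : Subalgebra ℂ ℂ[X]) : Submodule ℂ (LpT 2) :=
  (Submodule.span ℂ
    {u | ∃ f ∈ conductorIdeal A, ∃ h ∈ Hardy 2, u = mulL2 (polyLinfty f) h}).topologicalClosure

/-- The copy of `M ⊆ ℂ[z] / 𝔠` in `H² ⊖ 𝒞`: the class of a polynomial `p` corresponds to the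
orthogonal projection of `p` to `𝒞ᗮ`. -/
noncomputable def complementPart (A : Subalgebra ℂ ℂ[X])
    (M : Submodule (quotAlg A) (ℂ[X] ⧸ conductorIdeal A)) : Submodule ℂ (LpT 2) :=
  ((M.restrictScalars ℂ).comap (Ideal.Quotient.mkₐ ℂ (conductorIdeal A)).toLinearMap).map
    ((conductorSpace A)ᗮ.starProjection.toLinearMap ∘ₗ polyL2)

/-- The space `H²_M = M ⊕ 𝒞` (an orthogonal sum). -/
noncomputable def H2sub (A : Subalgebra ℂ ℂ[X])
    (M : Submodule (quotAlg A) (ℂ[X] ⧸ conductorIdeal A)) : Submodule ℂ (LpT 2) :=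
  complementPart A M ⊔ conductorSpace A

/-- The boundary values of the finite Blaschke product whose zeros, with multiplicity, are the
zeros of a generator of `𝔠`. -/
noncomputable def blaschke (A : Subalgebra ℂ ℂ[X]) (t : UnitAddCircle) : ℂ :=
  ((Submodule.IsPrincipal.generator (conductorIdeal A)).roots.map
    fun α => (fourier 1 t - α) / (1 - conj α * fourier 1 t)).prod

end HelsonLowdenslager

open HelsonLowdenslager

namespace HelsonLowdenslager

/-! Let `c` generate the conductor and let `W` be the closed `z`-invariant subspace generated by `N`
(`shiftHull`). Since `c ℂ[z] ⊆ A`, one has `c W ⊆ N ⊆ W`, so `N` differs little from a subspace to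
which the classical theory of invariant subspaces applies. By `reducing_or_exists_wandering` there
are two cases.

If `z W = W`, then `W` is invariant under all of `L^∞` (`mulL2_mem_of_reducing`). As `c` has no
zeros on `𝕋`, for `f ∈ N` and `h ∈ H^∞` the quotient `h f / c` lies in `W`, so `h f ∈ c W ⊆ N`; thus
`N` would be `H^∞`-invariant, which is excluded.

Otherwise `W ⊖ z W` contains a unit vector. It is orthogonal to its shifts, hence unimodular, and `W
= J H²` (`exists_unimodular_map_hardy`). Then `J⁻¹ N` is `A`-invariant and lies between `c H² = 𝒞`
and `H²`. Because `H² = ℂ[z] + 𝒞`, such a space is determined by the polynomials in it modulo `𝔠`,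
and these form the module `M` (`exists_eq_H2sub`). -/

/-! ### Multiplication operators on `L²(𝕋)` -/

theorem coeFn_mulL2 (a : LpT ∞) (f : LpT 2) :
    (mulL2 a f : UnitAddCircle → ℂ) =ᵐ[circleMeasure] fun t => a t * f t :=
  Lp.coeFn_lpSMul a f

/-- Multiplication by a function in `L^∞(𝕋)`, as an operator on `L²(𝕋)`. -/
noncomputable def mulCLM (a : LpT ∞) : LpT 2 →L[ℂ] LpT 2 :=
  LinearMap.mkContinuous
    { toFun := mulL2 a
      map_add' := fun f g => Lp.add_smul a f g
      map_smul' := fun c f => (Lp.smul_comm c a f).symm }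
    ‖a‖ (fun f => Lp.norm_smul_le a f)

theorem coeFn_mulCLM (a : LpT ∞) (f : LpT 2) :
    (mulCLM a f : UnitAddCircle → ℂ) =ᵐ[circleMeasure] fun t => a t * f t :=
  coeFn_mulL2 a f

theorem coeFn_mulCLM_toLp (φ : C(UnitAddCircle, ℂ)) (f : LpT 2) :
    (mulCLM (ContinuousMap.toLp ∞ circleMeasure ℂ φ) f : UnitAddCircle → ℂ)
      =ᵐ[circleMeasure] fun t => φ t * f t := by
  filter_upwards [coeFn_mulCLM (ContinuousMap.toLp ∞ circleMeasure ℂ φ) f,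
    ContinuousMap.coeFn_toLp (p := ∞) (𝕜 := ℂ) circleMeasure φ] with t h1 h2
  rw [h1, h2]

/-- The action of continuous functions on `L²(𝕋)` by multiplication. -/
noncomputable def mulCont : C(UnitAddCircle, ℂ) →ₐ[ℂ] (LpT 2 →L[ℂ] LpT 2) where
  toFun φ := mulCLM (ContinuousMap.toLp ∞ circleMeasure ℂ φ)
  map_one' := by
    ext1 f
    apply Lp.ext
    filter_upwards [coeFn_mulCLM_toLp 1 f] with t h1
    simp [h1]
  map_mul' φ ψ := by
    ext1 f
    apply Lp.ext
    rw [mul_apply_eq_comp]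
    filter_upwards [coeFn_mulCLM_toLp (φ * ψ) f, coeFn_mulCLM_toLp ψ f,
      coeFn_mulCLM_toLp φ (mulCLM (ContinuousMap.toLp ∞ circleMeasure ℂ ψ) f)] with t h1 h2 h3
    rw [h1, h3, h2, ContinuousMap.mul_apply, mul_assoc]
  map_zero' := by
    ext1 f
    apply Lp.ext
    rw [zero_apply]
    filter_upwards [coeFn_mulCLM_toLp 0 f, Lp.coeFn_zero ℂ 2 circleMeasure] with t h1 h2
    rw [h1, h2]
    simp
  map_add' φ ψ := by
    ext1 f
    apply Lp.ext
    rw [add_apply]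
    filter_upwards [coeFn_mulCLM_toLp (φ + ψ) f, coeFn_mulCLM_toLp φ f, coeFn_mulCLM_toLp ψ f,
      Lp.coeFn_add (mulCLM (ContinuousMap.toLp ∞ circleMeasure ℂ φ) f)
        (mulCLM (ContinuousMap.toLp ∞ circleMeasure ℂ ψ) f)] with t h1 h2 h3 h4
    rw [h1, h4, Pi.add_apply, h2, h3, ContinuousMap.add_apply, add_mul]
  commutes' c := by
    ext1 f
    apply Lp.ext
    have : (algebraMap ℂ (LpT 2 →L[ℂ] LpT 2) c) f = c • f := by
      simp [Algebra.algebraMap_eq_smul_one]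
    rw [this]
    filter_upwards [coeFn_mulCLM_toLp (algebraMap ℂ _ c) f, Lp.coeFn_smul c f] with t h1 h2
    simp [h1, h2]

theorem coeFn_mulCont (φ : C(UnitAddCircle, ℂ)) (f : LpT 2) :
    (mulCont φ f : UnitAddCircle → ℂ) =ᵐ[circleMeasure] fun t => φ t * f t :=
  coeFn_mulCLM_toLp φ f

theorem mulL2_polyLinfty (p : ℂ[X]) (f : LpT 2) :
    mulL2 (polyLinfty p) f = mulCont (polyCircle p) f := rfl

theorem norm_mulCont_le (φ : C(UnitAddCircle, ℂ)) : ‖mulCont φ‖ ≤ ‖φ‖ := by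
  refine ContinuousLinearMap.opNorm_le_bound _ (norm_nonneg _) fun f => ?_
  refine Lp.norm_le_mul_norm_of_ae_le_mul ?_
  filter_upwards [coeFn_mulCont φ f] with t h
  rw [h, norm_mul]
  exact mul_le_mul_of_nonneg_right (φ.norm_coe_le_norm t) (norm_nonneg _)

theorem mulCLM_mulCont_comm (a : LpT ∞) (φ : C(UnitAddCircle, ℂ)) (f : LpT 2) :
    mulCLM a (mulCont φ f) = mulCont φ (mulCLM a f) := by
  apply Lp.ext
  filter_upwards [coeFn_mulCLM a f, coeFn_mulCont φ f, coeFn_mulCLM a (mulCont φ f),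
    coeFn_mulCont φ (mulCLM a f)] with t h1 h2 h3 h4
  rw [h3, h4, h1, h2]
  ring

theorem mulCont_mul_apply (φ ψ : C(UnitAddCircle, ℂ)) (f : LpT 2) :
    mulCont (φ * ψ) f = mulCont φ (mulCont ψ f) := by
  rw [map_mul, mul_apply_eq_comp]

/-! ### Polynomials on the circle -/

theorem fourier_neg_one_mul_one :
    (fourier (-1) * fourier 1 : C(UnitAddCircle, ℂ)) = 1 := by
  ext t
  rw [ContinuousMap.mul_apply, ← fourier_add]
  simp

theorem fourier_one_pow (n : ℕ) : (fourier 1 : C(UnitAddCircle, ℂ)) ^ n = fourier n := by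
  induction n with
  | zero => ext t; simp
  | succ n ih =>
    ext t
    rw [pow_succ, ih, ContinuousMap.mul_apply, ← fourier_add]
    simp

theorem polyCircle_X_pow (n : ℕ) : polyCircle (X ^ n) = fourier n := by
  rw [polyCircle, map_pow, aeval_X, fourier_one_pow]

theorem polyCircle_X : polyCircle X = fourier 1 := aeval_X _

theorem polyCircle_apply (p : ℂ[X]) (t : UnitAddCircle) :
    polyCircle p t = p.eval (fourier 1 t) := by
  induction p using Polynomial.induction_on' with
  | add p q hp hq => rw [map_add, ContinuousMap.add_apply, hp, hq, eval_add]
  | monomial n c =>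
    simp [polyCircle, aeval_monomial]

theorem polyL2_eq (p : ℂ[X]) : polyL2 p = mulCont (polyCircle p) (polyL2 1) := by
  apply Lp.ext
  filter_upwards [coeFn_mulCont (polyCircle p) (polyL2 1),
    ContinuousMap.coeFn_toLp (p := 2) (𝕜 := ℂ) circleMeasure (polyCircle p),
    ContinuousMap.coeFn_toLp (p := 2) (𝕜 := ℂ) circleMeasure (polyCircle 1)] with t h1 h2 h3
  have h2' : polyL2 p t = polyCircle p t := h2
  have h3' : polyL2 1 t = polyCircle 1 t := h3
  rw [h1, h2', h3']
  simp

theorem polyL2_mul (p q : ℂ[X]) : polyL2 (p * q) = mulCont (polyCircle p) (polyL2 q) := by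
  rw [polyL2_eq, polyL2_eq q, map_mul, mulCont_mul_apply]

theorem mulCont_polyCircle_mem {S : Submodule ℂ (LpT 2)}
    (hS : ∀ f ∈ S, mulCont (fourier 1) f ∈ S) (p : ℂ[X]) :
    ∀ f ∈ S, mulCont (polyCircle p) f ∈ S := by
  induction p using Polynomial.induction_on with
  | C a =>
    intro f hf
    have : mulCont (polyCircle (C a)) f = a • f := by
      simp [polyCircle, Algebra.algebraMap_eq_smul_one]
    rw [this]
    exact S.smul_mem a hf
  | add p q hp hq =>
    intro f hf
    rw [map_add, map_add, add_apply]
    exact S.add_mem (hp f hf) (hq f hf)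
  | monomial n a ih =>
    intro f hf
    rw [pow_succ, ← mul_assoc, map_mul, mul_comm, mulCont_mul_apply, polyCircle_X]
    exact hS _ (ih f hf)

/-! ### Division by linear factors inside closed subspaces -/

/-- A closed subspace invariant under a strict contraction `T` contains `g` as soon as it contains
`g - T g`. -/
theorem mem_of_sub_apply_mem {S : Submodule ℂ (LpT 2)} (hS : IsClosed (S : Set (LpT 2)))
    {T : LpT 2 →L[ℂ] LpT 2} (hT : ‖T‖ < 1) (hTS : ∀ f ∈ S, T f ∈ S) {g : LpT 2}
    (hg : g - T g ∈ S) : g ∈ S := by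
  -- Partial sums of the Neumann series: `g - Tⁿ g = ∑_{k<n} Tᵏ (g - T g)`, and `Tⁿ g → 0`.
  have hmem : ∀ n : ℕ, g - (T ^ n) g ∈ S := by
    intro n
    induction n with
    | zero => simp
    | succ n ih =>
      have h : g - (T ^ (n + 1)) g = (g - T g) + T (g - (T ^ n) g) := by
        rw [pow_succ', mul_apply_eq_comp, map_sub]
        abel
      rw [h]
      exact S.add_mem hg (hTS _ ih)
  have hlim : Filter.Tendsto (fun n : ℕ => g - (T ^ n) g) Filter.atTop (𝓝 (g - 0)) := by
    refine tendsto_const_nhds.sub ?_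
    have h := tendsto_pow_atTop_nhds_zero_of_norm_lt_one hT
    have h' := ((ContinuousLinearMap.apply ℂ (LpT 2) g).continuous.tendsto 0).comp h
    rw [map_zero] at h'
    exact h'
  rw [sub_zero] at hlim
  exact hS.mem_of_tendsto hlim (Filter.Eventually.of_forall hmem)

theorem norm_smul_fourier_lt_one {α : ℂ} (hα : ‖α‖ < 1) (n : ℤ) :
    ‖mulCont (α • fourier n)‖ < 1 := by
  refine (norm_mulCont_le _).trans_lt ?_
  rw [norm_smul, fourier_norm, mul_one]
  exact hα

/-- Multiplication by `α zⁿ` is a strict contraction preserving `S`. The case `n = 1` serves the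
Blaschke denominators in `H²`, the case `n = -1` the zeros of the conductor in a reducing subspace.
-/
theorem mem_of_one_sub_smul_fourier {S : Submodule ℂ (LpT 2)} (hS : IsClosed (S : Set (LpT 2)))
    {n : ℤ} (hn : ∀ f ∈ S, mulCont (fourier n) f ∈ S) {α : ℂ} (hα : ‖α‖ < 1) {g : LpT 2}
    (hg : mulCont (1 - α • fourier n) g ∈ S) : g ∈ S := by
  refine mem_of_sub_apply_mem hS (norm_smul_fourier_lt_one hα n) (fun f hf => ?_) ?_
  · rw [map_smul, smul_apply]
    exact S.smul_mem α (hn f hf)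
  · rwa [map_sub, map_one, sub_apply, one_apply_eq_self] at hg

theorem mem_of_mulCont_multiset_prod {S : Submodule ℂ (LpT 2)} (s : Multiset ℂ)
    (φ : ℂ → C(UnitAddCircle, ℂ))
    (hφ : ∀ α ∈ s, ∀ g : LpT 2, mulCont (φ α) g ∈ S → g ∈ S) :
    ∀ g : LpT 2, mulCont (s.map φ).prod g ∈ S → g ∈ S := by
  induction s using Multiset.induction_on with
  | empty => intro g hg; simpa using hg
  | cons a s ih =>
    intro g hg
    rw [Multiset.map_cons, Multiset.prod_cons, mulCont_mul_apply] at hg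
    exact ih (fun α hα => hφ α (Multiset.mem_cons_of_mem hα)) g
      (hφ a (Multiset.mem_cons_self a s) _ hg)

/-- On the circle `z̄ (z - α) = 1 - α z̄`, which reduces to the previous kind of factor. -/
theorem mem_of_fourier_one_sub_smul {S : Submodule ℂ (LpT 2)} (hS : IsClosed (S : Set (LpT 2)))
    (hneg : ∀ f ∈ S, mulCont (fourier (-1)) f ∈ S) {α : ℂ} (hα : ‖α‖ < 1) {g : LpT 2}
    (hg : mulCont (fourier 1 - α • 1) g ∈ S) : g ∈ S := by
  refine mem_of_one_sub_smul_fourier hS hneg hα ?_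
  have h : (1 - α • fourier (-1) : C(UnitAddCircle, ℂ)) =
      fourier (-1) * (fourier 1 - α • 1) := by
    rw [mul_sub, fourier_neg_one_mul_one, mul_smul_comm, mul_one]
  rw [h, mulCont_mul_apply]
  exact hneg _ hg

/-! ### Uniqueness of Fourier coefficients -/

/-- If all Fourier coefficients of `f` vanish, then `f` is orthogonal to all continuous
functions. -/
theorem integral_continuous_mul_eq_zero {f : UnitAddCircle → ℂ} (hf : Integrable f circleMeasure)
    (h : ∀ n, fourierCoeff f n = 0) (φ : C(UnitAddCircle, ℂ)) :
    ∫ t, φ t * f t ∂circleMeasure = 0 := by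
  have hint : ∀ ψ : C(UnitAddCircle, ℂ), Integrable (fun t => ψ t * f t) circleMeasure := fun ψ =>
    hf.bdd_mul ψ.continuous.aestronglyMeasurable (ae_of_all _ ψ.norm_coe_le_norm)
  let L : C(UnitAddCircle, ℂ) →L[ℂ] ℂ := LinearMap.mkContinuous
    { toFun := fun ψ => ∫ t, ψ t * f t ∂circleMeasure
      map_add' := fun ψ χ => by
        simp only [ContinuousMap.add_apply, add_mul]
        exact integral_add (hint ψ) (hint χ)
      map_smul' := fun c ψ => by
        simp only [ContinuousMap.smul_apply, smul_eq_mul, mul_assoc, RingHom.id_apply]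
        exact integral_const_mul c _ }
    (∫ t, ‖f t‖ ∂circleMeasure) (fun ψ => by
      rw [← integral_mul_const]
      refine norm_integral_le_of_norm_le (hf.norm.mul_const _) (ae_of_all _ fun t => ?_)
      rw [norm_mul, mul_comm]
      exact mul_le_mul_of_nonneg_left (ψ.norm_coe_le_norm t) (norm_nonneg _))
  have hker : Submodule.span ℂ (Set.range (fourier (T := 1))) ≤ L.ker := by
    rw [Submodule.span_le]
    rintro _ ⟨n, rfl⟩
    have := h (-n)
    rw [fourierCoeff, neg_neg] at this
    exact this
  have htop := Submodule.topologicalClosure_minimal _ hker L.isClosed_ker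
  rw [span_fourier_closure_eq_top] at htop
  exact htop (Submodule.mem_top : φ ∈ ⊤)

/-- Uniqueness of Fourier coefficients in `L¹(𝕋)`. -/
theorem ae_eq_zero_of_fourierCoeff_eq_zero {f : UnitAddCircle → ℂ}
    (hf : Integrable f circleMeasure) (h : ∀ n, fourierCoeff f n = 0) :
    f =ᵐ[circleMeasure] 0 := by
  refine ae_eq_zero_of_forall_setIntegral_isClosed_eq_zero hf fun s hs => ?_
  rw [← integral_indicator hs.measurableSet]
  -- The indicator of a closed set is a pointwise limit of continuous functions with values in `[0,
  -- 1]`, so `|f|` dominates.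
  have hlim : Filter.Tendsto
      (fun n => ∫ t, ((hs.apprSeq n t : ℝ) : ℂ) * f t ∂circleMeasure) Filter.atTop
      (𝓝 (∫ t, s.indicator f t ∂circleMeasure)) := by
    refine tendsto_integral_of_dominated_convergence (fun t => ‖f t‖) (fun n => ?_) hf.norm
      (fun n => ae_of_all _ fun t => ?_) (ae_of_all _ fun t => ?_)
    · refine AEStronglyMeasurable.mul (Continuous.aestronglyMeasurable ?_) hf.1
      fun_prop
    · rw [norm_mul]
      refine mul_le_of_le_one_left (norm_nonneg _) ?_
      rw [Complex.norm_real, Real.norm_of_nonneg (NNReal.coe_nonneg _)]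
      exact_mod_cast HasOuterApproxClosed.apprSeq_apply_le_one hs n t
    · have h1 := tendsto_pi_nhds.1 (HasOuterApproxClosed.tendsto_apprSeq hs) t
      have hc : Continuous fun r : NNReal => ((r : ℝ) : ℂ) * f t := by fun_prop
      have h2 := (hc.tendsto _).comp h1
      have h3 : s.indicator f t = (((s.indicator (fun _ => (1 : NNReal)) t : NNReal) : ℝ) : ℂ) * f t := by
        by_cases ht : t ∈ s <;> simp [ht]
      rw [h3]
      exact h2
  refine tendsto_nhds_unique hlim ?_
  refine tendsto_const_nhds.congr fun n => ?_
  exact (integral_continuous_mul_eq_zero hf h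
    ⟨fun t => ((hs.apprSeq n t : ℝ) : ℂ), by fun_prop⟩).symm

/-! ### Fourier coefficients and the space `H²` -/

theorem integrable_conj_mul (f g : LpT 2) :
    Integrable (fun t => conj (f t) * g t) circleMeasure := by
  simpa only [RCLike.inner_apply'] using L2.integrable_inner (𝕜 := ℂ) f g

/-- Translates orthogonality to shifts into vanishing Fourier coefficients of the `L¹` function `f̄
g`. -/
theorem inner_mulCont_fourier_right (n : ℤ) (f g : LpT 2) :
    inner ℂ f (mulCont (fourier n) g) = fourierCoeff (fun t => conj (f t) * g t) (-n) := by
  rw [L2.inner_def, fourierCoeff, neg_neg]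
  refine integral_congr_ae ?_
  filter_upwards [coeFn_mulCont (fourier n) g] with t h
  rw [RCLike.inner_apply', h, smul_eq_mul]
  ring

theorem fourierCoeff_mulCont_fourier (k n : ℤ) (f : LpT 2) :
    fourierCoeff (mulCont (fourier k) f : UnitAddCircle → ℂ) n = fourierCoeff f (n - k) := by
  rw [fourierCoeff, fourierCoeff]
  refine integral_congr_ae ?_
  filter_upwards [coeFn_mulCont (fourier k) f] with t h
  rw [h, smul_eq_mul, smul_eq_mul, ← mul_assoc, ← fourier_add]
  congr 3
  ring

theorem isClosed_hardy_two : IsClosed (Hardy 2 : Set (LpT 2)) := by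
  have : (Hardy 2 : Set (LpT 2)) = ⋂ n : ℤ, ⋂ _ : n < 0, {f | fourierBasis.repr f n = 0} := by
    ext f
    simp [Hardy, fourierBasis_repr]
  rw [this]
  refine isClosed_iInter fun n => isClosed_iInter fun _ => isClosed_eq ?_ continuous_const
  simp_rw [HilbertBasis.repr_apply_apply]
  fun_prop

theorem fourier_one_mem_hardy : ∀ f ∈ Hardy 2, mulCont (fourier 1) f ∈ Hardy 2 := by
  intro f hf n hn
  rw [fourierCoeff_mulCont_fourier]
  exact hf _ (by lia)

theorem fourierLp_eq_polyL2 (n : ℕ) : fourierLp 2 (n : ℤ) = polyL2 (X ^ n) := by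
  change ContinuousMap.toLp 2 circleMeasure ℂ (fourier n)
    = ContinuousMap.toLp 2 circleMeasure ℂ (polyCircle (X ^ n))
  rw [polyCircle_X_pow]

theorem polyL2_mem_hardy (p : ℂ[X]) : polyL2 p ∈ Hardy 2 := by
  rw [polyL2_eq]
  refine mulCont_polyCircle_mem fourier_one_mem_hardy p _ fun n hn => ?_
  have h := fourierLp_eq_polyL2 0
  rw [pow_zero] at h
  rw [← h, fourierCoeff_congr_ae (coeFn_fourierLp 2 _), fourierCoeff_fourier]
  exact Pi.single_eq_of_ne (by simpa using hn.ne) _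

/-- Polynomials are dense in `H²`. -/
theorem hardy_two_le_of_polyL2_mem {S : Submodule ℂ (LpT 2)} (hS : IsClosed (S : Set (LpT 2)))
    (h : ∀ p, polyL2 p ∈ S) : Hardy 2 ≤ S := by
  intro f hf
  refine hS.mem_of_tendsto (hasSum_fourier_series_L2 f)
    (Filter.Eventually.of_forall fun s => S.sum_mem fun n _ => ?_)
  rcases lt_or_ge n 0 with hn | hn
  · rw [hf n hn, zero_smul]
    exact S.zero_mem
  · lift n to ℕ using hn
    rw [fourierLp_eq_polyL2]
    exact S.smul_mem _ (h _)

/-! ### Shift-invariant subspaces: the forms `J H²` and reducing -/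

/-- A unimodular measurable function defines an element of `L^∞(𝕋)`. -/
theorem exists_coeFn_ae_eq {v : UnitAddCircle → ℂ} (hv : AEStronglyMeasurable v circleMeasure)
    (h : ∀ᵐ t ∂circleMeasure, ‖v t‖ = 1) :
    ∃ J : LpT ∞, (J : UnitAddCircle → ℂ) =ᵐ[circleMeasure] v :=
  have hm : MemLp v ∞ circleMeasure := memLp_top_of_bound hv 1 (h.mono fun _ => le_of_eq)
  ⟨hm.toLp v, hm.coeFn_toLp⟩

/-- A unit vector of `L²(𝕋)` orthogonal to its shifts is unimodular. -/
theorem norm_eq_one_of_inner_shift_eq_zero {v : LpT 2} (hv : ‖v‖ = 1)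
    (h : ∀ n : ℕ, inner ℂ v (mulCont (fourier (n + 1)) v) = 0) :
    ∀ᵐ t ∂circleMeasure, ‖v t‖ = 1 := by
  -- `|v|²` has the Fourier coefficients of the constant `1`: negative indices by orthogonality,
  -- index `0` by the norm, positive indices by conjugation, as `|v|²` is real.
  have hcoef : ∀ n, fourierCoeff (fun t => conj (v t) * v t) n =
      Pi.single (M := fun _ => ℂ) 0 1 n := by
    have hneg : ∀ n : ℕ, fourierCoeff (fun t => conj (v t) * v t) (-(n + 1)) = 0 := fun n => by
      rw [← inner_mulCont_fourier_right, h]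
    intro n
    rcases lt_trichotomy n 0 with hn | rfl | hn
    · obtain ⟨k, rfl⟩ : ∃ k : ℕ, n = -(k + 1) := ⟨(-n - 1).toNat, by lia⟩
      rw [hneg, Pi.single_eq_of_ne hn.ne]
    · have h0 := inner_mulCont_fourier_right 0 v v
      have h1 : (fourier 0 : C(UnitAddCircle, ℂ)) = 1 := by ext t; simp
      rw [h1, map_one, one_apply_eq_self, inner_self_eq_norm_sq_to_K, hv, neg_zero] at h0
      rw [← h0]
      simp
    · obtain ⟨k, rfl⟩ : ∃ k : ℕ, n = k + 1 := ⟨(n - 1).toNat, by lia⟩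
      rw [Pi.single_eq_of_ne hn.ne', ← map_eq_zero (starRingEnd ℂ), ← hneg k, fourierCoeff,
        fourierCoeff, ← integral_conj]
      refine integral_congr_ae (ae_of_all _ fun t => ?_)
      simp only [smul_eq_mul, map_mul, Complex.conj_conj, neg_neg]
      rw [fourier_neg, Complex.conj_conj]
      ring
  have hone : Integrable (fun _ : UnitAddCircle => (-1 : ℂ)) circleMeasure := integrable_const _
  have hzero := ae_eq_zero_of_fourierCoeff_eq_zero ((integrable_conj_mul v v).add hone) (fun n => by
    rw [fourierCoeff.add (integrable_conj_mul v v) hone, Pi.add_apply, hcoef]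
    have : (fun _ : UnitAddCircle => (-1 : ℂ)) = (-1 : ℂ) • (fourier 0 : C(UnitAddCircle, ℂ)) := by
      ext t; simp
    rw [this, fourierCoeff.const_smul, fourierCoeff_fourier, smul_eq_mul]
    ring)
  filter_upwards [hzero] with t ht
  have h1 : (‖v t‖ ^ 2 : ℂ) = 1 := by
    rw [← Complex.conj_mul']
    exact add_neg_eq_zero.1 ht
  have h2 : ‖v t‖ ^ 2 = 1 := by exact_mod_cast h1
  exact (pow_eq_one_iff_of_nonneg (norm_nonneg _) two_ne_zero).1 h2

theorem mulCLM_cancel {J J' : LpT ∞} (hJ : ∀ᵐ t ∂circleMeasure, J t * J' t = 1) (f : LpT 2) :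
    mulCLM J (mulCLM J' f) = f := by
  apply Lp.ext
  filter_upwards [hJ, coeFn_mulCLM J (mulCLM J' f), coeFn_mulCLM J' f] with t h h1 h2
  rw [h1, h2, ← mul_assoc, h, one_mul]

/-- A shift-invariant subspace that contains a nonzero vector orthogonal to its shift is of the form
`J H²` with `J` unimodular. -/
theorem exists_unimodular_map_hardy {W : Submodule ℂ (LpT 2)} (hW : IsClosed (W : Set (LpT 2)))
    (hz : ∀ f ∈ W, mulCont (fourier 1) f ∈ W) {v : LpT 2} (hv : v ∈ W) (hv0 : v ≠ 0)
    (hortho : ∀ f ∈ W, inner ℂ v (mulCont (fourier 1) f) = 0) :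
    ∃ J J' : LpT ∞, (∀ᵐ t ∂circleMeasure, ‖J t‖ = 1) ∧ (∀ᵐ t ∂circleMeasure, J t * J' t = 1) ∧
      W = (Hardy 2).map (mulCLM J).toLinearMap := by
  wlog hnorm : ‖v‖ = 1 generalizing v
  · refine this (W.smul_mem (‖v‖⁻¹ : ℂ) hv) ?_ ?_ ?_
    · simp [hv0]
    · intro f hf
      rw [inner_smul_left, hortho f hf, mul_zero]
    · rw [norm_smul]
      simp [hv0]
  have hshift : ∀ (n : ℕ), ∀ f ∈ W, inner ℂ v (mulCont (fourier (n + 1)) f) = 0 := by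
    intro n f hf
    have h1 : (fourier (n + 1) : C(UnitAddCircle, ℂ)) = fourier 1 * polyCircle (X ^ n) := by
      rw [polyCircle_X_pow]
      ext t
      rw [ContinuousMap.mul_apply, ← fourier_add, add_comm]
    rw [h1, mulCont_mul_apply]
    exact hortho _ (mulCont_polyCircle_mem hz _ f hf)
  have hu := norm_eq_one_of_inner_shift_eq_zero hnorm fun n => hshift n v hv
  have hvm := Lp.aestronglyMeasurable v
  obtain ⟨J, hJ⟩ := exists_coeFn_ae_eq hvm hu
  obtain ⟨J', hJ'⟩ := exists_coeFn_ae_eq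
    (v := fun t => conj (v t)) (Complex.continuous_conj.comp_aestronglyMeasurable hvm)
    (hu.mono fun t ht => by rw [RCLike.norm_conj, ht])
  have hJJ : ∀ᵐ t ∂circleMeasure, J t * J' t = 1 := by
    filter_upwards [hJ, hJ', hu] with t h1 h2 h3
    rw [h1, h2, Complex.mul_conj', h3]
    simp
  refine ⟨J, J', ?_, hJJ, le_antisymm ?_ ?_⟩
  · filter_upwards [hJ, hu] with t h1 h2
    rw [h1, h2]
  · intro g hg
    refine ⟨mulCLM J' g, fun n hn => ?_, mulCLM_cancel hJJ g⟩
    obtain ⟨k, rfl⟩ : ∃ k : ℕ, n = -(k + 1) := ⟨(-n - 1).toNat, by lia⟩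
    -- Since `J' = v̄`, the coefficient of `J' g` at `-(k + 1)` is the inner product of `v` with
    -- `z^(k+1) g`.
    rw [← hshift k g hg, inner_mulCont_fourier_right]
    refine congrFun (fourierCoeff_congr_ae ?_) _
    filter_upwards [coeFn_mulCLM J' g, hJ'] with t h1 h2
    rw [h1, h2]
  · rw [Submodule.map_le_iff_le_comap]
    refine hardy_two_le_of_polyL2_mem (hW.preimage (mulCLM J).continuous) fun p => ?_
    have h1 : mulCLM J (polyL2 1) = v := by
      apply Lp.ext
      filter_upwards [coeFn_mulCLM J (polyL2 1), hJ,
        ContinuousMap.coeFn_toLp (p := 2) (𝕜 := ℂ) circleMeasure (polyCircle 1)] with t h1 h2 h3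
      have h3' : polyL2 1 t = polyCircle 1 t := h3
      rw [h1, h2, h3']
      simp
    change mulCLM J (polyL2 p) ∈ W
    rw [polyL2_eq, mulCLM_mulCont_comm, h1]
    exact mulCont_polyCircle_mem hz p v hv

/-- A closed subspace of `L²(𝕋)` that is invariant under the shift and its adjoint is invariant
under multiplication by `L^∞(𝕋)`. -/
theorem mulL2_mem_of_reducing {W : Submodule ℂ (LpT 2)} (hW : IsClosed (W : Set (LpT 2)))
    (hz : ∀ f ∈ W, mulCont (fourier 1) f ∈ W) (hz' : ∀ f ∈ W, mulCont (fourier (-1)) f ∈ W)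
    (a : LpT ∞) {f : LpT 2} (hf : f ∈ W) : mulL2 a f ∈ W := by
  have hall : ∀ n : ℤ, mulCont (fourier n) f ∈ W := by
    intro n
    induction n with
    | zero =>
      have h1 : (fourier 0 : C(UnitAddCircle, ℂ)) = 1 := by ext t; simp
      rwa [h1, map_one]
    | succ n ih =>
      have h1 : (fourier (n + 1) : C(UnitAddCircle, ℂ)) = fourier 1 * fourier n := by
        ext t
        rw [ContinuousMap.mul_apply, ← fourier_add, add_comm]
      rw [h1, mulCont_mul_apply]
      exact hz _ ih
    | pred n ih =>
      have h1 : (fourier (-n - 1) : C(UnitAddCircle, ℂ)) = fourier (-1) * fourier (-n) := by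
        ext t
        rw [ContinuousMap.mul_apply, ← fourier_add, sub_eq_add_neg, add_comm]
      rw [h1, mulCont_mul_apply]
      exact hz' _ ih
  have : CompleteSpace W := hW.completeSpace_coe
  rw [← Submodule.orthogonal_orthogonal W, Submodule.mem_orthogonal]
  intro g hg
  -- For `g ⊥ W`, orthogonality to every `zⁿ f`, `n ∈ ℤ`, forces `ḡ f = 0` almost everywhere, hence
  -- also `ḡ a f = 0`.
  have hzero := ae_eq_zero_of_fourierCoeff_eq_zero (integrable_conj_mul g f) fun n => by
    have := inner_mulCont_fourier_right (-n) g f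
    rw [neg_neg] at this
    rw [← this]
    exact Submodule.inner_left_of_mem_orthogonal (hall _) hg
  rw [L2.inner_def]
  refine integral_eq_zero_of_ae ?_
  filter_upwards [hzero, coeFn_mulL2 a f] with t h1 h2
  rw [RCLike.inner_apply', h2, mul_left_comm]
  have h1' : conj (g t) * f t = 0 := h1
  rw [h1', mul_zero, Pi.zero_apply]

/-! ### The conductor and its Blaschke product -/

theorem norm_fourier_apply (n : ℤ) (t : UnitAddCircle) : ‖fourier n t‖ = 1 := by
  rw [fourier_apply, Circle.norm_coe]

/-- A continuous function without zeros is a unit. -/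
theorem exists_mul_eq_one_of_forall_ne_zero {φ : C(UnitAddCircle, ℂ)} (h : ∀ t, φ t ≠ 0) :
    ∃ ψ : C(UnitAddCircle, ℂ), φ * ψ = 1 :=
  ⟨⟨fun t => (φ t)⁻¹, φ.continuous.inv₀ h⟩, by ext t; exact mul_inv_cancel₀ (h t)⟩

theorem isClosed_comap {S : Submodule ℂ (LpT 2)} (hS : IsClosed (S : Set (LpT 2)))
    (T : LpT 2 →L[ℂ] LpT 2) : IsClosed (S.comap T.toLinearMap : Set (LpT 2)) :=
  hS.preimage T.continuous

theorem isClosed_map_of_inverse {S : Submodule ℂ (LpT 2)} (hS : IsClosed (S : Set (LpT 2)))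
    {T U : LpT 2 →L[ℂ] LpT 2} (hTU : ∀ f, T (U f) = f) (hUT : ∀ f, U (T f) = f) :
    IsClosed (S.map T.toLinearMap : Set (LpT 2)) := by
  have : S.map T.toLinearMap = S.comap U.toLinearMap := by
    ext f
    constructor
    · rintro ⟨g, hg, rfl⟩
      change U (T g) ∈ S
      rwa [hUT]
    · exact fun hf => ⟨U f, hf, hTU f⟩
  rw [this]
  exact isClosed_comap hS U

theorem mulCont_cancel {φ ψ : C(UnitAddCircle, ℂ)} (h : φ * ψ = 1) (f : LpT 2) :
    mulCont φ (mulCont ψ f) = f := by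
  rw [← mulCont_mul_apply, h, map_one, one_apply_eq_self]

theorem isClosed_map_mulCont {S : Submodule ℂ (LpT 2)} (hS : IsClosed (S : Set (LpT 2)))
    {φ ψ : C(UnitAddCircle, ℂ)} (h : φ * ψ = 1) :
    IsClosed (S.map (mulCont φ).toLinearMap : Set (LpT 2)) :=
  isClosed_map_of_inverse hS (mulCont_cancel h) (mulCont_cancel ((mul_comm ψ φ).trans h))

/-- A generator of the conductor. -/
noncomputable abbrev conductorGen (A : Subalgebra ℂ ℂ[X]) : ℂ[X] :=
  Submodule.IsPrincipal.generator (conductorIdeal A)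

theorem conductorGen_mem (A : Subalgebra ℂ ℂ[X]) : conductorGen A ∈ conductorIdeal A :=
  Submodule.IsPrincipal.generator_mem _

theorem mem_conductorIdeal_iff (A : Subalgebra ℂ ℂ[X]) {f : ℂ[X]} :
    f ∈ conductorIdeal A ↔ conductorGen A ∣ f :=
  Submodule.IsPrincipal.mem_iff_generator_dvd _

/-- The support of the conductor lies in the open unit disc. -/
def ConductorSupportInDisc (A : Subalgebra ℂ ℂ[X]) : Prop :=
  ∀ α : ℂ, (∀ f ∈ conductorIdeal A, f.eval α = 0) → ‖α‖ < 1

section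

variable {A : Subalgebra ℂ ℂ[X]}

theorem norm_lt_one_of_eval_conductorGen (hA : ConductorSupportInDisc A)
    {α : ℂ} (h : (conductorGen A).eval α = 0) : ‖α‖ < 1 :=
  hA α fun _ hf => eval_eq_zero_of_dvd_of_eval_eq_zero ((mem_conductorIdeal_iff A).1 hf) h

/-- The support of the zero ideal is all of `ℂ`, which contains the point `1` outside the open disc.
-/
theorem conductorGen_ne_zero (hA : ConductorSupportInDisc A) : conductorGen A ≠ 0 := fun h => by
  have := norm_lt_one_of_eval_conductorGen hA (α := 1) (by rw [h, eval_zero])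
  simp at this

theorem exists_inv_conductorGen (hA : ConductorSupportInDisc A) :
    ∃ ψ, polyCircle (conductorGen A) * ψ = 1 := by
  refine exists_mul_eq_one_of_forall_ne_zero fun t ht => ?_
  rw [polyCircle_apply] at ht
  have := norm_lt_one_of_eval_conductorGen hA ht
  rw [norm_fourier_apply] at this
  exact lt_irrefl _ this

/-- The generator has no zeros on `𝕋`, so multiplication by it is a homeomorphism of `L²` and the
image of `H²` is already closed. -/
theorem conductorSpace_eq_map (hA : ConductorSupportInDisc A) : conductorSpace A =
    (Hardy 2).map (mulCont (polyCircle (conductorGen A))).toLinearMap := by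
  obtain ⟨ψ, hψ⟩ := exists_inv_conductorGen hA
  apply le_antisymm
  · refine Submodule.topologicalClosure_minimal _ ?_ (isClosed_map_mulCont isClosed_hardy_two hψ)
    rw [Submodule.span_le]
    rintro _ ⟨f, hf, h, hh, rfl⟩
    obtain ⟨s, rfl⟩ := (mem_conductorIdeal_iff A).1 hf
    refine ⟨mulCont (polyCircle s) h, mulCont_polyCircle_mem fourier_one_mem_hardy s h hh, ?_⟩
    rw [mulL2_polyLinfty, map_mul, mulCont_mul_apply]
    rfl
  · rintro _ ⟨h, hh, rfl⟩
    refine Submodule.le_topologicalClosure _ (Submodule.subset_span ?_)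
    exact ⟨_, conductorGen_mem A, h, hh, rfl⟩

theorem mem_conductorSpace_iff_exists_mulCont (hA : ConductorSupportInDisc A) {u : LpT 2} :
    u ∈ conductorSpace A ↔
      ∃ h ∈ Hardy 2, mulCont (polyCircle (conductorGen A)) h = u := by
  rw [conductorSpace_eq_map hA]
  exact Submodule.mem_map

theorem conductorGen_eq_prod (A : Subalgebra ℂ ℂ[X]) :
    conductorGen A = C (conductorGen A).leadingCoeff *
    ((conductorGen A).roots.map fun α => X - C α).prod :=
  (IsAlgClosed.splits (conductorGen A)).eq_prod_roots

theorem norm_lt_one_of_mem_roots (hA : ConductorSupportInDisc A)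
    {α : ℂ} (h : α ∈ (conductorGen A).roots) : ‖α‖ < 1 :=
  norm_lt_one_of_eval_conductorGen hA (isRoot_of_mem_roots h)

theorem mulCont_polyCircle_C (c : ℂ) (f : LpT 2) : mulCont (polyCircle (C c)) f = c • f := by
  simp [polyCircle, Algebra.algebraMap_eq_smul_one]

/-- Division by the generator of the conductor in a reducing subspace. -/
theorem mem_of_conductorGen_mul_mem (hA : ConductorSupportInDisc A)
    {W : Submodule ℂ (LpT 2)} (hW : IsClosed (W : Set (LpT 2)))
    (hz' : ∀ f ∈ W, mulCont (fourier (-1)) f ∈ W) {g : LpT 2}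
    (hg : mulCont (polyCircle (conductorGen A)) g ∈ W) : g ∈ W := by
  rw [conductorGen_eq_prod, map_mul, mulCont_mul_apply, mulCont_polyCircle_C,
    W.smul_mem_iff (leadingCoeff_ne_zero.2 (conductorGen_ne_zero hA)), map_multiset_prod,
    Multiset.map_map] at hg
  refine mem_of_mulCont_multiset_prod _ _ (fun α hα f hf => ?_) g hg
  refine mem_of_fourier_one_sub_smul hW hz' (norm_lt_one_of_mem_roots hA hα) ?_
  convert hf using 3
  ext t
  simp [polyCircle_apply]

/-- The product of the denominators of the Blaschke product. -/
noncomputable def blaschkeDenom (A : Subalgebra ℂ ℂ[X]) : C(UnitAddCircle, ℂ) :=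
  ((conductorGen A).roots.map fun α => 1 - conj α • fourier 1).prod

theorem mem_hardy_of_blaschkeDenom_mul_mem (hA : ConductorSupportInDisc A) {g : LpT 2}
    (hg : mulCont (blaschkeDenom A) g ∈ Hardy 2) : g ∈ Hardy 2 := by
  refine mem_of_mulCont_multiset_prod _ _ (fun α hα f hf => ?_) g hg
  refine mem_of_one_sub_smul_fourier isClosed_hardy_two fourier_one_mem_hardy ?_ hf
  rw [RCLike.norm_conj]
  exact norm_lt_one_of_mem_roots hA hα

theorem blaschkeDenom_mul_mem_hardy {g : LpT 2} (hg : g ∈ Hardy 2) :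
    mulCont (blaschkeDenom A) g ∈ Hardy 2 := by
  have : blaschkeDenom A =
      polyCircle ((conductorGen A).roots.map fun α => 1 - C (conj α) * X).prod := by
    rw [map_multiset_prod, Multiset.map_map, blaschkeDenom]
    congr 2
    funext α
    ext t
    simp [polyCircle_apply]
  rw [this]
  exact mulCont_polyCircle_mem fourier_one_mem_hardy _ g hg

theorem one_sub_conj_mul_fourier_ne_zero {α : ℂ} (hα : ‖α‖ < 1) (t : UnitAddCircle) :
    1 - conj α * fourier 1 t ≠ 0 := by
  intro h
  have h1 := congrArg norm (sub_eq_zero.1 h)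
  rw [norm_one, norm_mul, RCLike.norm_conj, norm_fourier_apply, mul_one] at h1
  exact hα.ne h1.symm

theorem blaschkeDenom_apply (t : UnitAddCircle) : blaschkeDenom A t =
    ((conductorGen A).roots.map fun α => 1 - conj α * fourier 1 t).prod := by
  have h := map_multiset_prod (ContinuousMap.evalAlgHom ℂ ℂ t)
    ((conductorGen A).roots.map fun α => 1 - conj α • (fourier 1 : C(UnitAddCircle, ℂ)))
  rw [Multiset.map_map] at h
  refine Eq.trans h ?_
  congr 2

theorem blaschkeDenom_ne_zero (hA : ConductorSupportInDisc A)
    (t : UnitAddCircle) : blaschkeDenom A t ≠ 0 := by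
  rw [blaschkeDenom_apply]
  refine Multiset.prod_ne_zero fun h => ?_
  obtain ⟨α, hα, h0⟩ := Multiset.mem_map.1 h
  exact one_sub_conj_mul_fourier_ne_zero (norm_lt_one_of_mem_roots hA hα) t h0

theorem polyCircle_conductorGen_apply (hA : ConductorSupportInDisc A)
    (t : UnitAddCircle) : polyCircle (conductorGen A) t =
    (conductorGen A).leadingCoeff * (blaschke A t * blaschkeDenom A t) := by
  rw [polyCircle_apply, blaschkeDenom_apply, blaschke, ← Multiset.prod_map_mul]
  conv_lhs => rw [conductorGen_eq_prod]
  rw [eval_mul, eval_C, eval_multiset_prod, Multiset.map_map]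
  congr 2
  refine Multiset.map_congr rfl fun α hα => ?_
  rw [div_mul_cancel₀ _ (one_sub_conj_mul_fourier_ne_zero (norm_lt_one_of_mem_roots hA hα) t)]
  simp

/-- `𝒞 = B H²`. -/
theorem mem_conductorSpace_iff (hA : ConductorSupportInDisc A) (u : LpT 2) : u ∈ conductorSpace A ↔
    ∃ h ∈ Hardy 2, (u : UnitAddCircle → ℂ) =ᵐ[circleMeasure] fun t => blaschke A t * h t := by
  have hc : (conductorGen A).leadingCoeff ≠ 0 := leadingCoeff_ne_zero.2 (conductorGen_ne_zero hA)
  rw [conductorSpace_eq_map hA]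
  constructor
  · rintro ⟨g, hg, rfl⟩
    refine ⟨(conductorGen A).leadingCoeff • mulCont (blaschkeDenom A) g,
      (Hardy 2).smul_mem _ (blaschkeDenom_mul_mem_hardy hg), ?_⟩
    filter_upwards [coeFn_mulCont (polyCircle (conductorGen A)) g,
      coeFn_mulCont (blaschkeDenom A) g,
      Lp.coeFn_smul (conductorGen A).leadingCoeff (mulCont (blaschkeDenom A) g)] with t h1 h2 h3
    refine h1.trans ?_
    rw [h3, Pi.smul_apply, h2, polyCircle_conductorGen_apply hA, smul_eq_mul]
    ring
  · rintro ⟨h, hh, hu⟩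
    obtain ⟨ψ, hψ⟩ := exists_mul_eq_one_of_forall_ne_zero (blaschkeDenom_ne_zero hA)
    -- The generator is its leading coefficient times `B` times the denominator of `B`; dividing `B
    -- h` by it leaves this function.
    refine ⟨(conductorGen A).leadingCoeff⁻¹ • mulCont ψ h, (Hardy 2).smul_mem _ ?_, ?_⟩
    · refine mem_hardy_of_blaschkeDenom_mul_mem hA ?_
      rwa [mulCont_cancel hψ]
    · change mulCont (polyCircle (conductorGen A))
        ((conductorGen A).leadingCoeff⁻¹ • mulCont ψ h) = u
      rw [map_smul]
      apply Lp.ext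
      filter_upwards [hu, coeFn_mulCont (polyCircle (conductorGen A)) (mulCont ψ h),
        coeFn_mulCont ψ h, Lp.coeFn_smul (conductorGen A).leadingCoeff⁻¹
          (mulCont (polyCircle (conductorGen A)) (mulCont ψ h))] with t h1 h2 h3 h4
      have h5 : blaschkeDenom A t * ψ t = 1 := DFunLike.congr_fun hψ t
      rw [h4, Pi.smul_apply, h2, h3, h1, polyCircle_conductorGen_apply hA, smul_eq_mul]
      field_simp
      linear_combination blaschke A t * h t * h5

end

/-! ### Subspaces between `𝒞` and `H²` -/

/-- `H² = ℂ[z] + 𝒞`. -/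
theorem exists_polyL2_add_of_mem_hardy {A : Subalgebra ℂ ℂ[X]} (hA : ConductorSupportInDisc A)
    {h : LpT 2} (hh : h ∈ Hardy 2) : ∃ p : ℂ[X], ∃ c ∈ conductorSpace A, polyL2 p + c = h := by
  -- Remainders modulo the generator span a finite-dimensional space, so its sum with `𝒞` is closed;
  -- it contains all polynomials, which are dense in `H²`.
  let V : Submodule ℂ (LpT 2) := (degreeLT ℂ (conductorGen A).natDegree).map polyL2
  have hfin : FiniteDimensional ℂ (degreeLT ℂ (conductorGen A).natDegree) :=
    (degreeLTEquiv ℂ _).symm.finiteDimensional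
  have hclosed : IsClosed ((conductorSpace A ⊔ V : Submodule ℂ (LpT 2)) : Set (LpT 2)) :=
    Submodule.isClosed_sup_finiteDimensional _ _ (Submodule.isClosed_topologicalClosure _)
  have hle := hardy_two_le_of_polyL2_mem hclosed fun p => by
    rw [← EuclideanDomain.div_add_mod p (conductorGen A), map_add]
    refine Submodule.add_mem_sup ?_ ⟨_, ?_, rfl⟩
    · rw [conductorSpace_eq_map hA, polyL2_mul]
      exact ⟨_, polyL2_mem_hardy _, rfl⟩
    · rw [SetLike.mem_coe, mem_degreeLT, ← degree_eq_natDegree (conductorGen_ne_zero hA)]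
      exact degree_mod_lt _ (conductorGen_ne_zero hA)
  obtain ⟨c, hc, _, ⟨p, -, rfl⟩, rfl⟩ := Submodule.mem_sup.1 (hle hh)
  exact ⟨p, c, hc, add_comm _ _⟩

theorem polyL2_mem_conductorSpace {A : Subalgebra ℂ ℂ[X]} {p : ℂ[X]} (hp : p ∈ conductorIdeal A) :
    polyL2 p ∈ conductorSpace A := by
  refine Submodule.le_topologicalClosure _ (Submodule.subset_span ?_)
  exact ⟨p, hp, polyL2 1, polyL2_mem_hardy 1, polyL2_eq p⟩

/-- Every subspace between `𝒞` and `H²` that is invariant under `A` is of the form `H²_M`. -/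
theorem exists_eq_H2sub {A : Subalgebra ℂ ℂ[X]} (hA : ConductorSupportInDisc A)
    {N : Submodule ℂ (LpT 2)} (hCN : conductorSpace A ≤ N) (hNH : N ≤ Hardy 2)
    (hinv : ∀ p ∈ A, ∀ f ∈ N, mulCont (polyCircle p) f ∈ N) :
    ∃ M : Submodule (quotAlg A) (ℂ[X] ⧸ conductorIdeal A), N = H2sub A M := by
  let M : Submodule (quotAlg A) (ℂ[X] ⧸ conductorIdeal A) :=
    { carrier := {x | ∃ p, Ideal.Quotient.mkₐ ℂ (conductorIdeal A) p = x ∧ polyL2 p ∈ N}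
      zero_mem' := ⟨0, map_zero _, by rw [map_zero]; exact N.zero_mem⟩
      add_mem' := by
        rintro _ _ ⟨p, rfl, hp⟩ ⟨q, rfl, hq⟩
        exact ⟨p + q, map_add _ _ _, by rw [map_add]; exact N.add_mem hp hq⟩
      smul_mem' := by
        rintro ⟨_, b, hb, rfl⟩ _ ⟨p, rfl, hp⟩
        refine ⟨b * p, map_mul _ _ _, ?_⟩
        rw [polyL2_mul]
        exact hinv b hb _ hp }
  -- Membership is independent of the representative because `𝔠` maps into `𝒞 ⊆ N`.
  have hM : ∀ p : ℂ[X], Ideal.Quotient.mkₐ ℂ (conductorIdeal A) p ∈ M ↔ polyL2 p ∈ N := by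
    intro p
    refine ⟨?_, fun h => ⟨p, rfl, h⟩⟩
    rintro ⟨q, hq, hqN⟩
    have hmem : p - q ∈ conductorIdeal A := Ideal.Quotient.eq.1 hq.symm
    rw [← sub_add_cancel p q, map_add]
    exact N.add_mem (hCN (polyL2_mem_conductorSpace hmem)) hqN
  have : CompleteSpace (conductorSpace A) :=
    (Submodule.isClosed_topologicalClosure _).completeSpace_coe
  have hproj : ∀ f : LpT 2, (conductorSpace A)ᗮ.starProjection f
      = f - (conductorSpace A).starProjection f := fun f =>
    Submodule.starProjection_orthogonal_val f
  refine ⟨M, le_antisymm ?_ (sup_le ?_ hCN)⟩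
  · intro n hn
    obtain ⟨p, c, hc, rfl⟩ := exists_polyL2_add_of_mem_hardy hA (hNH hn)
    have hp : polyL2 p ∈ N := by
      have := N.sub_mem hn (hCN hc)
      rwa [add_sub_cancel_right] at this
    have h1 : polyL2 p + c = (conductorSpace A)ᗮ.starProjection (polyL2 p)
        + ((conductorSpace A).starProjection (polyL2 p) + c) := by
      rw [hproj]
      abel
    rw [h1]
    refine Submodule.add_mem_sup ⟨p, (hM p).2 hp, rfl⟩ ?_
    exact Submodule.add_mem _ (Submodule.starProjection_apply_mem _ _) hc
  · rintro _ ⟨p, hp, rfl⟩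
    change (conductorSpace A)ᗮ.starProjection (polyL2 p) ∈ N
    rw [hproj]
    exact N.sub_mem ((hM p).1 hp) (hCN (Submodule.starProjection_apply_mem _ _))

/-! ### The wandering subspace and the shift-invariant hull -/

/-- A closed shift-invariant subspace is either invariant under the adjoint of the shift or contains
a nonzero vector orthogonal to its shift. -/
theorem reducing_or_exists_wandering {W : Submodule ℂ (LpT 2)} (hW : IsClosed (W : Set (LpT 2)))
    (hz : ∀ f ∈ W, mulCont (fourier 1) f ∈ W) :
    (∀ f ∈ W, mulCont (fourier (-1)) f ∈ W) ∨
      ∃ v ∈ W, v ≠ 0 ∧ ∀ f ∈ W, inner ℂ v (mulCont (fourier 1) f) = 0 := by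
  have hinv : (fourier 1 * fourier (-1) : C(UnitAddCircle, ℂ)) = 1 := by
    rw [mul_comm, fourier_neg_one_mul_one]
  let W' : Submodule ℂ (LpT 2) := W.map (mulCont (fourier 1)).toLinearMap
  have hle : W' ≤ W := by
    rintro _ ⟨f, hf, rfl⟩
    exact hz f hf
  have : CompleteSpace W' := (isClosed_map_mulCont hW hinv).completeSpace_coe
  -- `W = z W ⊕ (W ⊖ z W)`: a trivial second summand means `W = z W`, and otherwise any nonzero
  -- vector in it is wandering.
  have hsup := Submodule.sup_orthogonal_inf_of_hasOrthogonalProjection hle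
  by_cases hbot : W'ᗮ ⊓ W = ⊥
  · left
    rw [hbot, sup_bot_eq] at hsup
    intro f hf
    rw [← hsup] at hf
    obtain ⟨g, hg, rfl⟩ := hf
    change mulCont (fourier (-1)) (mulCont (fourier 1) g) ∈ W
    rwa [mulCont_cancel fourier_neg_one_mul_one]
  · right
    obtain ⟨v, ⟨hv', hv⟩, hv0⟩ := Submodule.exists_mem_ne_zero_of_ne_bot hbot
    exact ⟨v, hv, hv0, fun f hf => Submodule.inner_left_of_mem_orthogonal
      (Submodule.mem_map_of_mem (f := (mulCont (fourier 1)).toLinearMap) hf) hv'⟩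

/-- The closed shift-invariant subspace generated by `N`. -/
noncomputable def shiftHull (N : Submodule ℂ (LpT 2)) : Submodule ℂ (LpT 2) :=
  (Submodule.span ℂ {u | ∃ p : ℂ[X], ∃ f ∈ N, u = mulCont (polyCircle p) f}).topologicalClosure

theorem isClosed_shiftHull (N : Submodule ℂ (LpT 2)) : IsClosed (shiftHull N : Set (LpT 2)) :=
  Submodule.isClosed_topologicalClosure _

theorem le_shiftHull (N : Submodule ℂ (LpT 2)) : N ≤ shiftHull N := fun f hf =>
  Submodule.le_topologicalClosure _ (Submodule.subset_span ⟨1, f, hf, by simp⟩)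

theorem apply_mem_of_mem_closure_span {s : Set (LpT 2)} {S : Submodule ℂ (LpT 2)}
    (hS : IsClosed (S : Set (LpT 2))) (T : LpT 2 →L[ℂ] LpT 2) (h : ∀ u ∈ s, T u ∈ S) :
    ∀ f ∈ (Submodule.span ℂ s).topologicalClosure, T f ∈ S :=
  Submodule.topologicalClosure_minimal (t := S.comap T.toLinearMap) _
    (Submodule.span_le.2 h) (isClosed_comap hS T)

/-- Used with `q = z` for the shift-invariance of the hull, and with `q` the generator of `𝔠` to
carry the hull back into `N`. -/
theorem mulCont_mem_of_mem_shiftHull {N S : Submodule ℂ (LpT 2)} (hS : IsClosed (S : Set (LpT 2)))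
    (q : ℂ[X]) (h : ∀ p, ∀ f ∈ N, mulCont (polyCircle (q * p)) f ∈ S) :
    ∀ f ∈ shiftHull N, mulCont (polyCircle q) f ∈ S := by
  refine apply_mem_of_mem_closure_span hS _ ?_
  rintro _ ⟨p, f, hf, rfl⟩
  rw [← mulCont_mul_apply, ← map_mul]
  exact h p f hf

theorem fourier_one_mem_shiftHull (N : Submodule ℂ (LpT 2)) :
    ∀ f ∈ shiftHull N, mulCont (fourier 1) f ∈ shiftHull N := by
  rw [← polyCircle_X]
  exact mulCont_mem_of_mem_shiftHull (isClosed_shiftHull N) X fun p f hf =>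
    Submodule.le_topologicalClosure _ (Submodule.subset_span ⟨X * p, f, hf, rfl⟩)

theorem polyLinfty_mem_weakStarClosure {A : Subalgebra ℂ ℂ[X]} {p : ℂ[X]} (hp : p ∈ A) :
    polyLinfty p ∈ weakStarClosure A :=
  @subset_closure _ weakStar _ _ ⟨p, hp, rfl⟩

end HelsonLowdenslager

/-! ### The generalized Helson–Lowdenslager theorem -/

open HelsonLowdenslager
theorem theorem3 (A : Subalgebra ℂ ℂ[X])
    (hA : ∀ α : ℂ, (∀ f ∈ conductorIdeal A, f.eval α = 0) → ‖α‖ < 1)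
    (N : Submodule ℂ (LpT 2)) (hN_closed : IsClosed (N : Set (LpT 2)))
    (hN_inv : ∀ a ∈ weakStarClosure A, ∀ f ∈ N, mulL2 a f ∈ N)
    (hN_not : ¬ ∀ h ∈ Hardy ∞, ∀ f ∈ N, mulL2 h f ∈ N) :
    (∀ u : LpT 2, u ∈ conductorSpace A ↔
      ∃ h ∈ Hardy 2, (u : UnitAddCircle → ℂ) =ᵐ[circleMeasure] fun t => blaschke A t * h t) ∧
    ∃ (M : Submodule (quotAlg A) (ℂ[X] ⧸ conductorIdeal A)) (J : LpT ∞),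
      (∀ᵐ t ∂circleMeasure, ‖J t‖ = 1) ∧
      (N : Set (LpT 2)) = mulL2 J '' (H2sub A M : Set (LpT 2)) := by
  refine ⟨mem_conductorSpace_iff hA, ?_⟩
  have hinv : ∀ p ∈ A, ∀ f ∈ N, mulCont (polyCircle p) f ∈ N := fun p hp f hf => by
    rw [← mulL2_polyLinfty]
    exact hN_inv _ (polyLinfty_mem_weakStarClosure hp) f hf
  have hgen : ∀ f ∈ shiftHull N, mulCont (polyCircle (conductorGen A)) f ∈ N :=
    mulCont_mem_of_mem_shiftHull hN_closed _ fun p => hinv _ ((conductorGen_mem A).2 p)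
  have hz := fourier_one_mem_shiftHull N
  have hcl := isClosed_shiftHull N
  rcases reducing_or_exists_wandering hcl hz with hred | ⟨v, hv, hv0, hortho⟩
  · refine absurd (fun h _ f hf => ?_) hN_not
    obtain ⟨ψ, hψ⟩ := exists_inv_conductorGen hA
    -- Here `ψ` is the inverse of the generator on `𝕋`: once `h f` divided by the generator lies in
    -- the hull, multiplying back lands in `N`.
    have hdiv : mulCont ψ (mulL2 h f) ∈ shiftHull N := by
      refine mem_of_conductorGen_mul_mem hA hcl hred ?_
      rw [mulCont_cancel hψ]
      exact mulL2_mem_of_reducing hcl hz hred h (le_shiftHull N hf)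
    have := hgen _ hdiv
    rwa [mulCont_cancel hψ] at this
  · obtain ⟨J, J', hJ, hJJ, hW⟩ := exists_unimodular_map_hardy hcl hz hv hv0 hortho
    have hJJ' : ∀ᵐ t ∂circleMeasure, J' t * J t = 1 := hJJ.mono fun t ht => by rw [mul_comm, ht]
    have hmem : ∀ g, g ∈ shiftHull N ↔ ∃ f ∈ Hardy 2, mulCLM J f = g := fun g => by
      rw [hW]
      exact Submodule.mem_map
    have hcomap : ∀ f, f ∈ N.comap (mulCLM J).toLinearMap ↔ mulCLM J f ∈ N := fun f =>
      Submodule.mem_comap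
    -- The preimage of `N` is `J⁻¹ N`. It contains `𝒞` because the generator carries `J H²`, the
    -- hull, into `N`, and it lies in `H²` because `N ⊆ J H²`.
    obtain ⟨M, hM⟩ := exists_eq_H2sub hA (N := N.comap (mulCLM J).toLinearMap)
      (by
        intro u hu
        obtain ⟨f, hf, rfl⟩ := (mem_conductorSpace_iff_exists_mulCont hA).1 hu
        rw [hcomap, mulCLM_mulCont_comm]
        exact hgen _ ((hmem _).2 ⟨f, hf, rfl⟩))
      (by
        intro f hf
        rw [hcomap] at hf
        obtain ⟨g, hg, hgf⟩ := (hmem _).1 (le_shiftHull N hf)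
        have h2 := congrArg (mulCLM J') hgf
        rw [mulCLM_cancel hJJ', mulCLM_cancel hJJ'] at h2
        rwa [← h2])
      (fun p hp f hf => by
        rw [hcomap] at hf ⊢
        rw [mulCLM_mulCont_comm]
        exact hinv p hp _ hf)
    refine ⟨M, J, hJ, ?_⟩
    rw [← hM]
    ext f
    constructor
    · intro hf
      have h1 : mulCLM J (mulCLM J' f) = f := mulCLM_cancel hJJ f
      refine ⟨mulCLM J' f, (hcomap _).2 ?_, h1⟩
      rwa [h1]
    · rintro ⟨g, hg, rfl⟩
      exact (hcomap g).1 hg
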